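/- For $r\ge 0$ let $D_r=\{z\in\mathbb C:|z|<r\}$. Let $0\le r\le e^{-1/(2e)}$, let $f$ and $g$ be holomorphic on $D_r$ with $f(0)=g(0)=0$, suppose that $f$ is proper as a map of $D_r$ onto its image $f(D_r)$ (that is, $f^{-1}(K)\cap D_r$ is compact for every compact $K\subset f(D_r)$), and suppose that $g(D_r)\subset f(D_r)$. Then $$\iint_{|z|\le r^2}|g'(\rho e^{i\theta})|^2\,\rho\,d\rho\,d\theta\;\le\;\iint_{|z|\le r}|f'(\rho e^{i\theta})|^2\,\rho\,d\rho\,d\theta ,$$ where the right-hand side is an element of $[0,\infty]$ and may be $+\infty$ (the circle $|z|=r$, on which $f'$ need not be defined, has measure zero; for $r=0$ both sides are $0$). -/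

import Mathlib

open MeasureTheory

/-! With `g = ∑ bₙ zⁿ`, Parseval turns the left side into `π ∑ n |bₙ|² r^(4n)`. The bound on `r`
gives `n r^(2n) ≤ 1`, leaving `π ∑ |bₙ|² r^(2n)`, the limit as `ρ ↑ r` of `π` times the mean of
`|g|²` over `|z| = ρ`. The Alexander–Taylor–Ullman inequality bounds this by the area of `g(D_r)`,
hence of `f(D_r)`, and `∬ |f'|²` is that area counted with multiplicity.

For that inequality (`pi_mul_circleAverage_le_volume_image`), let `K` be the image of `|z| ≤ ρ` and
write `π|w|²`, `w = g(ρe^{iθ})`, as `w` times the Cauchy transform at `w` of a disc about `0`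
containing `K`. After integration in `θ`, points `ζ` outside `K` contribute nothing; those in `K`
are controlled by the Ahlfors–Beurling bound `norm_integral_inv_sub_le`. -/

/-! ### Polar coordinates on discs -/

theorem Complex.polarCoord_symm_eq_circleMap (p : ℝ × ℝ) :
    Complex.polarCoord.symm p = circleMap 0 p.1 p.2 := by
  rw [Complex.polarCoord_symm_apply, circleMap_zero, Complex.exp_mul_I]
  simp

theorem lintegral_ball_eq_polar {F : ℂ → ENNReal} (hF : Measurable F) (R : ℝ) :
    ∫⁻ z in Metric.ball 0 R, F z = ∫⁻ s in Set.Ioo 0 R,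
      ENNReal.ofReal s * ∫⁻ θ in Set.Ioo (-Real.pi) Real.pi, F (circleMap 0 s θ) := by
  have hcm : Measurable fun p : ℝ × ℝ => circleMap 0 p.1 p.2 := by
    unfold circleMap; fun_prop
  rw [← lintegral_indicator measurableSet_ball, ← Complex.lintegral_comp_polarCoord_symm,
    polarCoord_target, Measure.volume_eq_prod, setLIntegral_prod _ (by
      refine Measurable.aemeasurable ?_
      simp_rw [Complex.polarCoord_symm_eq_circleMap, smul_eq_mul]
      have := hF.indicator (measurableSet_ball (x := (0 : ℂ)) (ε := R))
      fun_prop)]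
  rw [show Set.Ioo 0 R = Set.Ioi 0 ∩ Set.Iio R from rfl, ← Measure.restrict_restrict' measurableSet_Iio]
  rw [Measure.restrict_restrict measurableSet_Ioi, Set.inter_comm, ← Measure.restrict_restrict measurableSet_Iio,
    ← lintegral_indicator measurableSet_Iio]
  refine setLIntegral_congr_fun measurableSet_Ioi fun s (hs : 0 < s) => ?_
  simp only [Complex.polarCoord_symm_eq_circleMap, smul_eq_mul]
  by_cases h : s < R
  · rw [Set.indicator_of_mem (by exact h), ← lintegral_const_mul _ (by fun_prop)]
    refine lintegral_congr fun θ => ?_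
    rw [Set.indicator_of_mem]
    simpa [abs_of_pos hs] using h
  · rw [Set.indicator_of_notMem (by exact h)]
    refine (lintegral_congr fun θ => ?_).trans lintegral_zero
    rw [Set.indicator_of_notMem, mul_zero]
    simpa [abs_of_pos hs] using h

theorem integral_Ioo_circleMap (f : ℂ → ℂ) (s : ℝ) :
    ∫ θ in Set.Ioo (-Real.pi) Real.pi, f (circleMap 0 s θ) =
      (2 * Real.pi) • Real.circleAverage f 0 s := by
  rw [Real.circleAverage_eq_integral_add (-Real.pi), smul_inv_smul₀ (by positivity),
    intervalIntegral.integral_comp_add_right (fun θ => f (circleMap 0 s θ)),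
    ← integral_Ioc_eq_integral_Ioo, intervalIntegral.integral_of_le (by linarith [Real.pi_pos])]
  congr 3 <;> ring

theorem integral_ball_eq_polar {f : ℂ → ℂ} (hf : Measurable f) {R : ℝ}
    (hi : IntegrableOn f (Metric.ball 0 R)) :
    ∫ z in Metric.ball 0 R, f z = ∫ s in Set.Ioo 0 R,
      s • (2 * Real.pi) • Real.circleAverage f 0 s := by
  have hcm : Measurable fun p : ℝ × ℝ => circleMap 0 p.1 p.2 := by
    unfold circleMap; fun_prop
  have hm := hf.indicator (measurableSet_ball (x := (0 : ℂ)) (ε := R))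
  rw [← integral_indicator measurableSet_ball, ← Complex.integral_comp_polarCoord_symm,
    polarCoord_target, Measure.volume_eq_prod, setIntegral_prod]
  · rw [show Set.Ioo 0 R = Set.Ioi 0 ∩ Set.Iio R from rfl, ← setIntegral_indicator measurableSet_Iio]
    refine setIntegral_congr_fun measurableSet_Ioi fun s (hs : 0 < s) => ?_
    simp only [Complex.polarCoord_symm_eq_circleMap]
    by_cases h : s < R
    · rw [Set.indicator_of_mem (by exact h), integral_smul, ← integral_Ioo_circleMap]
      congr 2
      ext θ
      rw [Set.indicator_of_mem]
      simpa [abs_of_pos hs] using h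
    · rw [Set.indicator_of_notMem (by exact h), integral_smul]
      convert smul_zero s
      convert integral_zero ℝ ℂ with θ
      rw [Set.indicator_of_notMem]
      simpa [abs_of_pos hs] using h
  · refine ⟨Measurable.aestronglyMeasurable ?_, ?_⟩
    · simp_rw [Complex.polarCoord_symm_eq_circleMap]
      fun_prop
    · have h2 := ((integrable_indicator_iff measurableSet_ball).2 hi).2
      rw [hasFiniteIntegral_iff_enorm, ← Complex.lintegral_comp_polarCoord_symm] at h2
      rw [hasFiniteIntegral_iff_enorm]
      refine lt_of_le_of_lt (le_of_eq ?_) h2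
      rw [polarCoord_target, Measure.volume_eq_prod]
      refine setLIntegral_congr_fun (measurableSet_Ioi.prod measurableSet_Ioo) fun p hp => ?_
      simp only [enorm_smul, smul_eq_mul]
      rw [Real.enorm_of_nonneg (le_of_lt hp.1)]

/-! ### The Cauchy kernel on discs and the Ahlfors–Beurling estimate -/

theorem lintegral_ball_enorm_inv (R : ℝ) :
    ∫⁻ z in Metric.ball (0 : ℂ) R, ‖z⁻¹‖ₑ = ENNReal.ofReal R * ENNReal.ofReal (2 * Real.pi) := by
  rw [lintegral_ball_eq_polar (by fun_prop)]
  rw [setLIntegral_congr_fun (g := fun _ => ENNReal.ofReal (2 * Real.pi)) measurableSet_Ioo]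
  · simp [mul_comm]
  · intro s hs
    have h : ∀ θ, ‖(circleMap 0 s θ)⁻¹‖ₑ = (ENNReal.ofReal s)⁻¹ := fun θ => by
      rw [← ofReal_norm, norm_inv, norm_circleMap_zero, abs_of_pos hs.1, ENNReal.ofReal_inv_of_pos hs.1]
    simp only [h, lintegral_const, Measure.restrict_apply MeasurableSet.univ, Set.univ_inter,
      Real.volume_Ioo]
    rw [← mul_assoc, ENNReal.mul_inv_cancel (by simpa using hs.1) (by simp), one_mul]
    congr 1; ring

theorem circleAverage_inv_sub_of_lt {w : ℂ} {s : ℝ} (hs : 0 < s) (h : s < ‖w‖) :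
    Real.circleAverage (fun z => (w - z)⁻¹) 0 s = w⁻¹ := by
  have := circleAverage_of_differentiable_on_off_countable (f := fun z => (w - z)⁻¹) (c := 0) (R := s)
    Set.countable_empty ?_ ?_
  · simpa using this
  · refine ContinuousOn.inv₀ (by fun_prop) fun z hz h0 => ?_
    rw [sub_eq_zero] at h0
    subst h0
    simp [abs_of_pos hs] at hz
    linarith
  · intro z hz
    refine DifferentiableAt.inv (by fun_prop) fun h0 => ?_
    rw [sub_eq_zero] at h0
    subst h0
    simp [abs_of_pos hs] at hz
    linarith

/-- The pole is inside, but on `|z| = s` the substitution `s² = z z̄` makes the integrand the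
conjugate of `z / (w̄ z - s²)`, which is holomorphic on the closed disc and vanishes at `0`. -/
theorem circleAverage_inv_sub_of_gt {w : ℂ} {s : ℝ} (h : ‖w‖ < s) :
    Real.circleAverage (fun z => (w - z)⁻¹) 0 s = 0 := by
  have hs : 0 < s := (norm_nonneg w).trans_lt h
  have hne : ∀ z ∈ Metric.closedBall (0 : ℂ) |s|, (starRingEnd ℂ) w * z - (s : ℂ) ^ 2 ≠ 0 := by
    intro z hz h0
    rw [sub_eq_zero] at h0
    have := congrArg norm h0
    simp [abs_of_pos hs] at this hz
    have h1 : ‖w‖ * ‖z‖ ≤ ‖w‖ * s := by gcongr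
    nlinarith
  have key := circleAverage_of_differentiable_on_off_countable
    (f := fun z => z / ((starRingEnd ℂ) w * z - (s : ℂ) ^ 2)) (c := 0) (R := s)
    Set.countable_empty (ContinuousOn.div (by fun_prop) (by fun_prop) hne)
    (fun z hz => DifferentiableAt.div (by fun_prop) (by fun_prop)
      (hne z (Metric.ball_subset_closedBall hz.1)))
  rw [zero_div] at key
  have h2 : ∀ z ∈ Metric.sphere (0 : ℂ) |s|, (w - z)⁻¹ =
      (starRingEnd ℂ) (z / ((starRingEnd ℂ) w * z - (s : ℂ) ^ 2)) := by
    intro z hz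
    have hz' : ‖z‖ = s := by simpa [abs_of_pos hs] using hz
    have hz0 : (starRingEnd ℂ) z ≠ 0 := by
      rw [Ne, map_eq_zero, ← norm_eq_zero, hz']; exact hs.ne'
    have e : (s : ℂ) ^ 2 = z * (starRingEnd ℂ) z := by
      rw [Complex.mul_conj, Complex.normSq_eq_norm_sq, hz']; simp
    rw [map_div₀, map_sub, map_mul, Complex.conj_conj, map_pow, Complex.conj_ofReal, e, ← sub_mul,
      div_mul_cancel_right₀ hz0]
  rw [Real.circleAverage_congr_sphere (fun z hz => h2 z hz)]
  rw [Real.circleAverage_def] at key ⊢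
  have h3 := intervalIntegral.intervalIntegral_conj (𝕜 := ℂ) (μ := volume)
    (f := fun θ => circleMap 0 s θ / ((starRingEnd ℂ) w * circleMap 0 s θ - (s : ℂ) ^ 2)) (a := 0) (b := 2 * Real.pi)
  rw [smul_eq_zero] at key ⊢
  right
  rw [h3, map_eq_zero]
  exact key.resolve_left (by positivity)

theorem lintegral_ball_enorm_inv_sub_le (w c : ℂ) (R : ℝ) :
    ∫⁻ z in Metric.ball c R, ‖(w - z)⁻¹‖ₑ ≤
      ENNReal.ofReal (‖w - c‖ + R) * ENNReal.ofReal (2 * Real.pi) := by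
  have hsub : Metric.ball c R ⊆ Metric.ball w (‖w - c‖ + R) :=
    Metric.ball_subset_ball' (by rw [dist_comm, dist_eq_norm]; linarith)
  refine (lintegral_mono_set hsub).trans (le_of_eq ?_)
  rw [← lintegral_ball_enorm_inv, ← lintegral_indicator measurableSet_ball,
    ← lintegral_indicator measurableSet_ball, ← lintegral_sub_left_eq_self _ w]
  refine lintegral_congr fun z => ?_
  simp [Set.indicator]

theorem integrableOn_ball_inv_sub (w c : ℂ) (R : ℝ) :
    IntegrableOn (fun z => (w - z)⁻¹) (Metric.ball c R) := by
  refine ⟨Measurable.aestronglyMeasurable (by fun_prop), ?_⟩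
  exact (lintegral_ball_enorm_inv_sub_le w c R).trans_lt
    (ENNReal.mul_lt_top ENNReal.ofReal_lt_top ENNReal.ofReal_lt_top)

/-- Only circles of radius `s < |w|` contribute, giving `2π w⁻¹ ∫₀^|w| s ds = π |w|² / w`. -/
theorem integral_ball_zero_inv_sub {w : ℂ} {R : ℝ} (h : ‖w‖ ≤ R) :
    ∫ z in Metric.ball (0 : ℂ) R, (w - z)⁻¹ = Real.pi * (starRingEnd ℂ) w := by
  rw [integral_ball_eq_polar (by fun_prop) (integrableOn_ball_inv_sub w 0 R)]
  have h1 : ∫ s in Set.Ioo 0 R, s • (2 * Real.pi) • Real.circleAverage (fun z => (w - z)⁻¹) 0 s =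
      ∫ s in Set.Ioo 0 R, (Set.Iio ‖w‖).indicator (fun s : ℝ => s • ((2 * Real.pi) • w⁻¹)) s := by
    refine setIntegral_congr_ae measurableSet_Ioo ?_
    filter_upwards [Measure.ae_ne volume ‖w‖] with s hs hs2
    rcases lt_or_gt_of_ne hs with h3 | h3
    · rw [Set.indicator_of_mem (by exact h3), circleAverage_inv_sub_of_lt hs2.1 h3]
    · rw [Set.indicator_of_notMem (by simpa using h3.le), circleAverage_inv_sub_of_gt h3, smul_zero,
        smul_zero]
  rw [h1, setIntegral_indicator measurableSet_Iio, Set.Ioo_inter_Iio, min_eq_right h,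
    integral_smul_const, ← integral_Ioc_eq_integral_Ioo, ← intervalIntegral.integral_of_le (norm_nonneg w),
    integral_id]
  by_cases hw : w = 0
  · simp [hw]
  · have e : (‖w‖ : ℂ) ^ 2 = w * (starRingEnd ℂ) w := by
      rw [Complex.mul_conj, Complex.normSq_eq_norm_sq]; simp
    simp only [Complex.real_smul]
    push_cast
    rw [e]
    field_simp
    simp

theorem integral_ball_inv_sub {w c : ℂ} {R : ℝ} (h : ‖w - c‖ ≤ R) :
    ∫ z in Metric.ball c R, (w - z)⁻¹ = Real.pi * (starRingEnd ℂ) (w - c) := by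
  rw [← integral_ball_zero_inv_sub h, ← integral_indicator measurableSet_ball,
    ← integral_indicator measurableSet_ball, ← integral_add_right_eq_self _ c]
  refine integral_congr_ae (Filter.Eventually.of_forall fun z => ?_)
  simp [Set.indicator, sub_sub, add_comm]

/-- The Ahlfors–Beurling estimate for the Cauchy transform of a bounded set. -/
theorem norm_integral_inv_sub_le {K : Set ℂ} (hK : MeasurableSet K) (hb : Bornology.IsBounded K)
    (w : ℂ) : ‖∫ z in K, (w - z)⁻¹‖ ≤ √(Real.pi * volume.real K) := by
  obtain ⟨R, hR⟩ := hb.subset_ball 0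
  have hfin : volume K ≠ ⊤ := hb.measure_lt_top.ne
  rcases eq_or_ne (volume K) 0 with h0 | h0
  · rw [Measure.restrict_eq_zero.2 h0]; simpa using by positivity
  have hpos : 0 < volume.real K := ENNReal.toReal_pos h0 hfin
  -- The radius of a disc with the area of `K`.
  set a := √(volume.real K / Real.pi) with ha
  have hapos : 0 < a := by positivity
  have ha2 : Real.pi * a ^ 2 = volume.real K := by
    rw [ha, Real.sq_sqrt (by positivity)]; field_simp
  have hsq : √(Real.pi * volume.real K) = Real.pi * a := by
    rw [← ha2, show Real.pi * (Real.pi * a ^ 2) = (Real.pi * a) ^ 2 by ring,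
      Real.sqrt_sq (by positivity)]
  obtain ⟨u, hu, huI⟩ : ∃ u : ℂ, ‖u‖ = 1 ∧ u * (∫ z in K, (w - z)⁻¹) = ‖∫ z in K, (w - z)⁻¹‖ := by
    generalize ∫ z in K, (w - z)⁻¹ = I
    rcases eq_or_ne I 0 with h | h
    · exact ⟨1, by simp, by simp [h]⟩
    · have : (‖I‖ : ℂ) ≠ 0 := by simpa using h
      exact ⟨‖I‖ / I, by simp [h], by field_simp⟩
  -- After rotation by `u`, this disc, with `w` on its boundary, is the superlevel set `Re(u/(w-z))
  -- > 1/(2a)`; among sets of its area it maximizes the integral.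
  set D := Metric.ball (w - a * u) a with hD
  set φ : ℂ → ℝ := fun z => (u * (w - z)⁻¹).re - 1 / (2 * a) with hφ
  have hcD : ‖w - (w - a * u)‖ ≤ a := by simp [hu, abs_of_pos hapos]
  have hiK : IntegrableOn (fun z => (w - z)⁻¹) K := (integrableOn_ball_inv_sub w 0 R).mono_set hR
  have hiD : IntegrableOn (fun z => (w - z)⁻¹) D := integrableOn_ball_inv_sub w _ a
  have hDfin : volume D ≠ ⊤ := measure_ball_lt_top.ne
  have hint : ∀ s : Set ℂ, volume s ≠ ⊤ → IntegrableOn (fun z => (w - z)⁻¹) s →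
      IntegrableOn φ s ∧
      ∫ z in s, φ z = (u * ∫ z in s, (w - z)⁻¹).re - volume.real s * (1 / (2 * a)) := by
    intro s hs hi
    have h1 : IntegrableOn (fun z => (u * (w - z)⁻¹).re) s := (hi.const_mul u).re
    have h2 : IntegrableOn (fun _ : ℂ => 1 / (2 * a)) s := integrableOn_const hs
    refine ⟨h1.sub h2, ?_⟩
    rw [hφ, integral_sub h1 h2, setIntegral_const, ← integral_const_mul, smul_eq_mul]
    congr 1
    exact integral_re (hi.const_mul u)
  have hsign : ∀ z, z ∈ D ↔ 0 < φ z := by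
    intro z
    simp only [hD, Metric.mem_ball, hφ]
    rcases eq_or_ne z w with h | h
    -- At the pole `0⁻¹ = 0` makes `φ` negative, consistent with `w` lying on the boundary of the
    -- open disc `D`.
    · subst h
      simp [hu, abs_of_pos hapos, hapos.le]
    · have hv : w - z ≠ 0 := sub_ne_zero.2 h.symm
      obtain ⟨v, rfl⟩ : ∃ v, z = w - v := ⟨w - z, by ring⟩
      simp only [sub_sub_cancel] at hv ⊢
      have hv2 : 0 < Complex.normSq v := Complex.normSq_pos.2 hv
      have hu2 : Complex.normSq u = 1 := by rw [Complex.normSq_eq_norm_sq, hu]; norm_num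
      have e1 : (u * v⁻¹).re = (u.re * v.re + u.im * v.im) / Complex.normSq v := by
        simp [Complex.mul_re, Complex.inv_re, Complex.inv_im]; ring
      have e2 : dist (w - v) (w - a * u) ^ 2 =
          Complex.normSq v - 2 * a * (u.re * v.re + u.im * v.im) + a ^ 2 := by
        rw [dist_eq_norm, show w - v - (w - a * u) = a * u - v by ring, ← Complex.normSq_eq_norm_sq,
          ← mul_one (a ^ 2), ← hu2]
        simp [Complex.normSq_apply]; ring
      rw [e1, sub_pos, div_lt_div_iff₀ (by positivity) hv2, ← sq_lt_sq₀ dist_nonneg hapos.le, e2]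
      constructor <;> intro <;> linarith
  obtain ⟨hφK, hIK⟩ := hint K hfin hiK
  obtain ⟨hφD, hID⟩ := hint D hDfin hiD
  have hle : ∫ z in K, φ z ≤ ∫ z in D, φ z := by
    rw [← integral_indicator hK, ← integral_indicator measurableSet_ball]
    refine integral_mono (hφK.integrable_indicator hK) (hφD.integrable_indicator measurableSet_ball)
      fun z => ?_
    change K.indicator φ z ≤ D.indicator φ z
    by_cases h2 : z ∈ D
    · rw [Set.indicator_of_mem h2]
      exact Set.indicator_le_self' (fun _ _ => ((hsign z).1 h2).le) z
    · rw [Set.indicator_of_notMem h2]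
      exact Set.indicator_apply_nonpos fun _ => not_lt.1 fun h => h2 ((hsign z).2 h)
  have hvD : volume.real D = Real.pi * a ^ 2 := by
    rw [hD, Measure.real, Complex.volume_ball]
    simp [hapos.le, mul_comm]
  have hcc : u * (Real.pi * (starRingEnd ℂ) (a * u)) = ((Real.pi * a : ℝ) : ℂ) := by
    have : u * (starRingEnd ℂ) u = 1 := by
      rw [Complex.mul_conj, Complex.normSq_eq_norm_sq, hu]; simp
    rw [map_mul, Complex.conj_ofReal, show u * (Real.pi * (a * (starRingEnd ℂ) u)) =
      Real.pi * a * (u * (starRingEnd ℂ) u) by ring, this]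
    push_cast; ring
  rw [hIK, hID, huI, integral_ball_inv_sub hcD, sub_sub_cancel, hcc, Complex.ofReal_re,
    Complex.ofReal_re, hvD, ← ha2] at hle
  rw [hsq]
  linarith

/-! ### The Alexander–Taylor–Ullman inequality -/

theorem continuous_comp_circleMap {g : ℂ → ℂ} {r ρ : ℝ} (hg : ContinuousOn g (Metric.ball 0 r))
    (hρ : 0 ≤ ρ) (hρr : ρ < r) : Continuous fun θ => g (circleMap 0 ρ θ) :=
  hg.comp_continuous (continuous_circleMap 0 ρ) fun θ => by simpa [abs_of_nonneg hρ] using hρr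

/-- Mean value property: `g / (g - ζ)` has no pole in the disc and vanishes at the centre. -/
theorem integral_circleMap_div_sub_eq_zero {g : ℂ → ℂ} {r ρ : ℝ}
    (hg : DifferentiableOn ℂ g (Metric.ball 0 r)) (hg0 : g 0 = 0) (hρ : 0 ≤ ρ) (hρr : ρ < r)
    {ζ : ℂ} (hζ : ζ ∉ g '' Metric.closedBall 0 ρ) :
    ∫ θ in Set.Ioc 0 (2 * Real.pi),
      g (circleMap 0 ρ θ) * (g (circleMap 0 ρ θ) - ζ)⁻¹ = 0 := by
  have hsub : Metric.closedBall (0 : ℂ) ρ ⊆ Metric.ball 0 r := Metric.closedBall_subset_ball hρr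
  have hne : ∀ z ∈ Metric.closedBall (0 : ℂ) ρ, g z - ζ ≠ 0 := fun z hz h =>
    hζ ⟨z, hz, sub_eq_zero.1 h⟩
  have key := circleAverage_of_differentiable_on_off_countable
    (f := fun z => g z * (g z - ζ)⁻¹) (c := 0) (R := ρ) Set.countable_empty (by
      rw [abs_of_nonneg hρ]
      have := hg.continuousOn.mono hsub
      exact this.mul ((this.sub continuousOn_const).inv₀ hne)) (by
      rw [abs_of_nonneg hρ]
      intro z hz
      have hz' := Metric.ball_subset_closedBall hz.1
      have := hg.differentiableAt (Metric.isOpen_ball.mem_nhds (hsub hz'))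
      exact this.mul ((this.sub_const ζ).inv (hne z hz')))
  rw [hg0, zero_mul, Real.circleAverage_def, smul_eq_zero] at key
  rw [← intervalIntegral.integral_of_le Real.two_pi_pos.le]
  exact key.resolve_left (by positivity)

/-- The Alexander–Taylor–Ullman inequality: the mean of `‖g‖²` over a circle is controlled by the
area of the image of the disc. -/
theorem pi_mul_circleAverage_le_volume_image {g : ℂ → ℂ} {r ρ : ℝ}
    (hg : DifferentiableOn ℂ g (Metric.ball 0 r)) (hg0 : g 0 = 0) (hρ : 0 ≤ ρ) (hρr : ρ < r) :
    Real.pi * Real.circleAverage (fun z => ‖g z‖ ^ 2) 0 ρ ≤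
      volume.real (g '' Metric.closedBall 0 ρ) := by
  have hsub : Metric.closedBall (0 : ℂ) ρ ⊆ Metric.ball 0 r := Metric.closedBall_subset_ball hρr
  set K := g '' Metric.closedBall 0 ρ with hKdef
  have hK : IsCompact K :=
    (isCompact_closedBall 0 ρ).image_of_continuousOn (hg.continuousOn.mono hsub)
  obtain ⟨R, hR⟩ := hK.isBounded.subset_ball 0
  set γ : ℝ → ℂ := fun θ => g (circleMap 0 ρ θ) with hγdef
  have hγ : Continuous γ := continuous_comp_circleMap hg.continuousOn hρ hρr
  have hγR : ∀ θ, ‖γ θ‖ ≤ R := fun θ => by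
    have : γ θ ∈ K := ⟨_, by simp [abs_of_nonneg hρ], rfl⟩
    exact (mem_ball_zero_iff.1 (hR this)).le
  set ν := volume.restrict (Set.Ioc 0 (2 * Real.pi)) with hν
  have hfin : IsFiniteMeasure ν := by rw [hν]; infer_instance
  set B := Metric.ball (0 : ℂ) R with hB
  have hBK : MeasurableSet (B \ K) := measurableSet_ball.diff hK.measurableSet
  have hprod : Integrable (Function.uncurry fun θ ζ => γ θ * (γ θ - ζ)⁻¹)
      (ν.prod (volume.restrict (B \ K))) := by
    have hm : Measurable (Function.uncurry fun θ ζ => γ θ * (γ θ - ζ)⁻¹) := by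
      have := hγ.measurable
      simp only [Function.uncurry_def]
      fun_prop
    refine ⟨hm.aestronglyMeasurable, ?_⟩
    rw [hasFiniteIntegral_iff_enorm, lintegral_prod _ (by fun_prop)]
    refine lt_of_le_of_lt (lintegral_mono (g := fun _ => ENNReal.ofReal R *
      (ENNReal.ofReal (R + R) * ENNReal.ofReal (2 * Real.pi))) fun θ => ?_) ?_
    · simp only [Function.uncurry_apply_pair, enorm_mul]
      rw [lintegral_const_mul _ (by fun_prop)]
      refine mul_le_mul' ?_ ?_
      · rw [← ofReal_norm]; exact ENNReal.ofReal_le_ofReal (hγR θ)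
      · refine (lintegral_mono_set Set.sdiff_subset).trans
          ((lintegral_ball_enorm_inv_sub_le (γ θ) 0 R).trans ?_)
        gcongr
        simpa using hγR θ
    · rw [lintegral_const]
      exact ENNReal.mul_lt_top (ENNReal.mul_lt_top ENNReal.ofReal_lt_top
        (ENNReal.mul_lt_top ENNReal.ofReal_lt_top ENNReal.ofReal_lt_top)) (measure_lt_top _ _)
  set I : ℝ → ℂ := fun θ => ∫ ζ in K, (γ θ - ζ)⁻¹ with hI
  set J : ℝ → ℂ := fun θ => ∫ ζ in B \ K, γ θ * (γ θ - ζ)⁻¹ with hJ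
  have hJint : Integrable J ν := hprod.integral_prod_left
  have hJ0 : ∫ θ, J θ ∂ν = 0 := by
    rw [hJ, integral_integral_swap hprod]
    exact setIntegral_eq_zero_of_forall_eq_zero fun ζ hζ =>
      integral_circleMap_div_sub_eq_zero hg hg0 hρ hρr hζ.2
  have hsplit : ∀ θ, ((Real.pi * ‖γ θ‖ ^ 2 : ℝ) : ℂ) = γ θ * I θ + J θ := by
    intro θ
    have h1 := integral_ball_inv_sub (w := γ θ) (c := 0) (R := R) (by simpa using hγR θ)
    have h2 := integrableOn_ball_inv_sub (γ θ) 0 R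
    rw [← hB, ← Set.union_sdiff_cancel hR, setIntegral_union Set.disjoint_sdiff_right hBK
      (h2.mono_set hR) (h2.mono_set Set.sdiff_subset)] at h1
    rw [hJ, hI]
    simp only
    rw [integral_const_mul, ← mul_add, h1, sub_zero, mul_left_comm, Complex.mul_conj,
      Complex.normSq_eq_norm_sq]
    push_cast; ring
  have hci : ∀ {E : Type} [NormedAddCommGroup E] {h : ℝ → E}, Continuous h → Integrable h ν :=
    fun hh => (hh.integrableOn_Icc (a := 0) (b := 2 * Real.pi)).mono_set Set.Ioc_subset_Icc_self
  have hLint : Integrable (fun θ => ((Real.pi * ‖γ θ‖ ^ 2 : ℝ) : ℂ)) ν := hci (by fun_prop)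
  have hIint : Integrable (fun θ => γ θ * I θ) ν :=
    (hLint.sub hJint).congr (Filter.Eventually.of_forall fun θ => by simp only [Pi.sub_apply, hsplit θ, add_sub_cancel_right])
  have hA : ((∫ θ, Real.pi * ‖γ θ‖ ^ 2 ∂ν : ℝ) : ℂ) = ∫ θ, γ θ * I θ ∂ν := by
    rw [← integral_complex_ofReal, integral_congr_ae (Filter.Eventually.of_forall hsplit),
      integral_add hIint hJint, hJ0, add_zero]
  set S := √(Real.pi * volume.real K) with hS
  have hS2 : S ^ 2 = Real.pi * volume.real K := Real.sq_sqrt (by positivity)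
  -- Ahlfors–Beurling followed by AM–GM, weighted so that half of `π‖γ‖²` can be absorbed on the
  -- left after integration.
  have hbound : ∀ θ, ‖γ θ * I θ‖ ≤ Real.pi * ‖γ θ‖ ^ 2 / 2 + volume.real K / 2 := by
    intro θ
    have h1 : ‖I θ‖ ≤ S := norm_integral_inv_sub_le hK.measurableSet hK.isBounded (γ θ)
    rw [norm_mul]
    have h2 : ‖γ θ‖ * ‖I θ‖ ≤ ‖γ θ‖ * S := by gcongr
    have h3 : 0 ≤ (Real.pi * ‖γ θ‖ - S) ^ 2 := sq_nonneg _
    have h4 : 2 * Real.pi * (‖γ θ‖ * S) ≤ Real.pi * (Real.pi * ‖γ θ‖ ^ 2 + volume.real K) := by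
      rw [mul_add, ← hS2]; linarith
    have := Real.pi_pos
    nlinarith
  have hle : ∫ θ, Real.pi * ‖γ θ‖ ^ 2 ∂ν ≤
      ∫ θ, (Real.pi * ‖γ θ‖ ^ 2 / 2 + volume.real K / 2) ∂ν := by
    calc _ ≤ ‖((∫ θ, Real.pi * ‖γ θ‖ ^ 2 ∂ν : ℝ) : ℂ)‖ := by
          rw [Complex.norm_real]; exact le_abs_self _
      _ ≤ _ := by
          rw [hA]
          exact norm_integral_le_of_norm_le (hci (by fun_prop)) (Filter.Eventually.of_forall hbound)
  have hν2 : ν.real Set.univ = 2 * Real.pi := by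
    rw [hν, measureReal_restrict_apply_univ, Real.volume_real_Ioc_of_le Real.two_pi_pos.le, sub_zero]
  rw [integral_add (hci (by fun_prop)) (integrable_const _), integral_div, integral_const, hν2,
    integral_const_mul, smul_eq_mul] at hle
  rw [Real.circleAverage_def, intervalIntegral.integral_of_le Real.two_pi_pos.le, smul_eq_mul]
  change Real.pi * ((2 * Real.pi)⁻¹ * ∫ θ, ‖γ θ‖ ^ 2 ∂ν) ≤ _
  have hpi := Real.pi_pos
  have : Real.pi * ((2 * Real.pi)⁻¹ * ∫ θ, ‖γ θ‖ ^ 2 ∂ν) = (∫ θ, ‖γ θ‖ ^ 2 ∂ν) / 2 := by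
    field_simp
  rw [this]
  nlinarith

/-! ### Area of a holomorphic image -/

theorem Complex.volume_image_le_lintegral_enorm_deriv_sq {f : ℂ → ℂ} {s : Set ℂ} (hs : IsOpen s)
    (hf : DifferentiableOn ℂ f s) :
    volume (f '' s) ≤ ∫⁻ z in s, ‖deriv f z‖ₑ ^ 2 := by
  refine (addHaar_image_le_lintegral_abs_det_fderiv volume hs.measurableSet
    (f' := fun z => (ContinuousLinearMap.toSpanSingleton ℂ (deriv f z)).restrictScalars ℝ)
    fun z hz => ?_).trans (le_of_eq ?_)
  · exact ((hf.differentiableAt (hs.mem_nhds hz)).hasDerivAt.hasFDerivAt.restrictScalars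
      ℝ).hasFDerivWithinAt
  · refine lintegral_congr fun z => ?_
    have : ((ContinuousLinearMap.toSpanSingleton ℂ (deriv f z)).restrictScalars ℝ).det =
        ‖deriv f z‖ ^ 2 := by
      rw [← Complex.normSq_eq_norm_sq, ContinuousLinearMap.det, ← LinearMap.det_toMatrix
        Complex.basisOneI, Matrix.det_fin_two]
      simp [LinearMap.toMatrix_apply, Complex.normSq_apply]
    rw [this, abs_of_nonneg (by positivity), ENNReal.ofReal_pow (norm_nonneg _), ofReal_norm]

/-! ### Taylor coefficients, Parseval and area integrals -/

theorem fourierCoeffOn_comp_circleMap (h : ℂ → ℂ) {s : ℝ} (hs : 0 < s) (n : ℤ) :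
    fourierCoeffOn Real.two_pi_pos (fun θ => h (circleMap 0 s θ)) n =
      (s : ℂ) ^ n * Real.circleAverage (fun z => z ^ (-n) * h z) 0 s := by
  have hs' : (s : ℂ) ≠ 0 := by exact_mod_cast hs.ne'
  rw [fourierCoeffOn_eq_integral, Real.circleAverage_def, mul_smul_comm,
    ← intervalIntegral.integral_const_mul, sub_zero, one_div]
  congr 1
  refine intervalIntegral.integral_congr fun θ _ => ?_
  simp only [fourier_coe_apply, smul_eq_mul]
  rw [← mul_assoc, circleMap_zero, mul_zpow, ← mul_assoc, ← zpow_add₀ hs', add_neg_cancel, zpow_zero,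
    one_mul, ← Complex.exp_int_mul]
  congr 2
  have := Real.pi_ne_zero
  push_cast
  field_simp

theorem circleAverage_zpow_neg_mul {h : ℂ → ℂ} {r s : ℝ}
    (hh : DifferentiableOn ℂ h (Metric.ball 0 r)) (hs : 0 < s) (hsr : s < r) (n : ℕ) :
    Real.circleAverage (fun z => z ^ (-(n : ℤ)) * h z) 0 s =
      iteratedDeriv n h 0 / n.factorial := by
  have hd : DiffContOnCl ℂ h (Metric.ball 0 s) :=
    (hh.mono (Metric.closedBall_subset_ball hsr)).diffContOnCl_ball subset_rfl
  have := hd.circleIntegral_one_div_sub_center_pow_smul hs n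
  rw [Real.circleAverage_eq_circleIntegral hs.ne']
  have e : ∀ z : ℂ, (z - 0)⁻¹ • (z ^ (-(n : ℤ)) * h z) = (1 / (z - 0) ^ (n + 1)) • h z := by
    intro z
    simp only [sub_zero, smul_eq_mul, zpow_neg, zpow_natCast, one_div, pow_succ, mul_inv]
    ring
  simp_rw [e]
  rw [this, smul_eq_mul, smul_eq_mul]
  have := Complex.two_pi_I_ne_zero
  field_simp

theorem circleAverage_pow_succ_mul {h : ℂ → ℂ} {r s : ℝ}
    (hh : DifferentiableOn ℂ h (Metric.ball 0 r)) (hs : 0 < s) (hsr : s < r) (n : ℕ) :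
    Real.circleAverage (fun z => z ^ (n + 1) * h z) 0 s = 0 := by
  have hd : DifferentiableOn ℂ (fun z => z ^ (n + 1) * h z) (Metric.closedBall 0 |s|) := by
    rw [abs_of_pos hs]
    exact (differentiableOn_id.pow _).mul (hh.mono (Metric.closedBall_subset_ball hsr))
  simpa using (hd.diffContOnCl_ball subset_rfl).circleAverage

/-- **Parseval's identity** for the Taylor coefficients of a holomorphic function. -/
theorem hasSum_norm_taylorCoeff_sq {h : ℂ → ℂ} {r s : ℝ}
    (hh : DifferentiableOn ℂ h (Metric.ball 0 r)) (hs : 0 < s) (hsr : s < r) :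
    HasSum (fun n : ℕ => ‖iteratedDeriv n h 0 / n.factorial‖ ^ 2 * s ^ (2 * n))
      (Real.circleAverage (fun z => ‖h z‖ ^ 2) 0 s) := by
  have hγ := continuous_comp_circleMap hh.continuousOn hs.le hsr
  obtain ⟨C, hC⟩ := (isCompact_Icc (a := 0) (b := 2 * Real.pi)).exists_bound_of_continuousOn
    hγ.continuousOn
  have hL2 : MemLp (fun θ => h (circleMap 0 s θ)) 2 (volume.restrict (Set.Ioc 0 (2 * Real.pi))) :=
    MemLp.of_bound hγ.aestronglyMeasurable C ((ae_restrict_iff' measurableSet_Ioc).2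
      (Filter.Eventually.of_forall fun θ hθ => hC θ (Set.Ioc_subset_Icc_self hθ)))
  have key := hasSum_sq_fourierCoeffOn Real.two_pi_pos hL2
  rw [sub_zero, ← Real.circleAverage_def (f := fun z => ‖h z‖ ^ 2)] at key
  simp_rw [fourierCoeffOn_comp_circleMap h hs] at key
  rw [← Nat.cast_injective.hasSum_iff (fun n hn => ?_)] at key
  · convert key using 2 with n
    rw [Function.comp_apply, circleAverage_zpow_neg_mul hh hs hsr, zpow_natCast, norm_mul, norm_pow,
      Complex.norm_real, Real.norm_of_nonneg hs.le]
    ring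
  -- Negative frequencies vanish by holomorphy, so the sum over `ℤ` reduces to `ℕ`.
  · obtain ⟨m, rfl⟩ : ∃ m : ℕ, n = -((m + 1 : ℕ) : ℤ) := by
      rcases n with n | n
      · exact absurd ⟨n, rfl⟩ hn
      · exact ⟨n, rfl⟩
    simp_rw [neg_neg, zpow_natCast]
    rw [circleAverage_pow_succ_mul hh hs hsr]
    simp

theorem lintegral_pow_two_mul_add_one {t : ℝ} (ht : 0 ≤ t) (n : ℕ) :
    ∫⁻ s in Set.Ioo 0 t, ENNReal.ofReal (s ^ (2 * n + 1)) =
      ENNReal.ofReal (t ^ (2 * (n + 1)) / (2 * (n + 1))) := by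
  rw [← ofReal_integral_eq_lintegral_ofReal]
  · rw [← integral_Ioc_eq_integral_Ioo, ← intervalIntegral.integral_of_le ht, integral_pow]
    congr 1
    push_cast
    rw [zero_pow (by omega), sub_zero]
    congr 1
    ring
  · exact ((continuous_pow _).integrableOn_Icc (a := 0) (b := t)).mono_set Set.Ioo_subset_Icc_self
  · exact (ae_restrict_iff' measurableSet_Ioo).2
      (Filter.Eventually.of_forall fun s hs => pow_nonneg hs.1.le _)

theorem lintegral_ball_enorm_sq_eq_tsum {h : ℂ → ℂ} (hm : Measurable h) {r t : ℝ}
    (hh : DifferentiableOn ℂ h (Metric.ball 0 r)) (ht : 0 ≤ t) (htr : t ≤ r) :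
    ∫⁻ z in Metric.ball 0 t, ‖h z‖ₑ ^ 2 = ∑' n : ℕ,
      ENNReal.ofReal (Real.pi * ‖iteratedDeriv n h 0 / n.factorial‖ ^ 2 *
        (t ^ (2 * (n + 1)) / (n + 1))) := by
  rw [lintegral_ball_eq_polar (by fun_prop)]
  have h1 : ∀ s ∈ Set.Ioo 0 t, ENNReal.ofReal s *
      ∫⁻ θ in Set.Ioo (-Real.pi) Real.pi, ‖h (circleMap 0 s θ)‖ₑ ^ 2 =
      ∑' n : ℕ, ENNReal.ofReal (2 * Real.pi * ‖iteratedDeriv n h 0 / n.factorial‖ ^ 2) *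
        ENNReal.ofReal (s ^ (2 * n + 1)) := by
    intro s hs
    have hγ := continuous_comp_circleMap hh.continuousOn hs.1.le (hs.2.trans_le htr)
    have hsum := hasSum_norm_taylorCoeff_sq hh hs.1 (hs.2.trans_le htr)
    have h2 : ∫⁻ θ in Set.Ioo (-Real.pi) Real.pi, ‖h (circleMap 0 s θ)‖ₑ ^ 2 =
        ENNReal.ofReal (2 * Real.pi * Real.circleAverage (fun z => ‖h z‖ ^ 2) 0 s) := by
      have h3 : ∀ θ, ‖h (circleMap 0 s θ)‖ₑ ^ 2 = ENNReal.ofReal (‖h (circleMap 0 s θ)‖ ^ 2) :=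
        fun θ => by rw [ENNReal.ofReal_pow (norm_nonneg _), ofReal_norm]
      simp_rw [h3]
      rw [← ofReal_integral_eq_lintegral_ofReal _ (Filter.Eventually.of_forall fun _ => sq_nonneg _)]
      · congr 1
        rw [Real.circleAverage_eq_integral_add (-Real.pi),
          intervalIntegral.integral_comp_add_right (fun θ => ‖h (circleMap 0 s θ)‖ ^ 2),
          ← integral_Ioc_eq_integral_Ioo, intervalIntegral.integral_of_le (by linarith [Real.pi_pos]),
          smul_eq_mul, mul_inv_cancel_left₀ (by positivity)]
        congr 3 <;> ring
      · exact ((hγ.norm.pow 2).integrableOn_Icc).mono_set Set.Ioo_subset_Icc_self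
    rw [h2, ← hsum.tsum_eq, ← tsum_mul_left, ← ENNReal.ofReal_mul hs.1.le, ← tsum_mul_left,
      ENNReal.ofReal_tsum_of_nonneg _ ((hsum.summable.mul_left _).mul_left _)]
    · refine tsum_congr fun n => ?_
      rw [← ENNReal.ofReal_mul (by positivity)]
      congr 1; ring
    · have := hs.1
      intro n; positivity
  rw [setLIntegral_congr_fun measurableSet_Ioo h1, lintegral_tsum fun n => by fun_prop]
  refine tsum_congr fun n => ?_
  rw [lintegral_const_mul _ (by fun_prop), lintegral_pow_two_mul_add_one ht,
    ← ENNReal.ofReal_mul (by positivity)]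
  congr 1
  field_simp

theorem Complex.closedBall_ae_eq_ball (t : ℝ) :
    Metric.closedBall (0 : ℂ) t =ᵐ[volume] Metric.ball (0 : ℂ) t := by
  rw [← Metric.ball_union_sphere]
  exact union_ae_eq_left_of_ae_eq_empty (ae_eq_empty.2 (Measure.addHaar_sphere volume 0 t))

theorem lintegral_ball_enorm_deriv_sq_eq_tsum {g : ℂ → ℂ} {r t : ℝ}
    (hg : DifferentiableOn ℂ g (Metric.ball 0 r)) (ht : 0 ≤ t) (htr : t ≤ r) :
    ∫⁻ z in Metric.ball 0 t, ‖deriv g z‖ₑ ^ 2 = ∑' n : ℕ,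
      ENNReal.ofReal (Real.pi * ((n + 1) *
        ‖iteratedDeriv (n + 1) g 0 / (n + 1).factorial‖ ^ 2 * t ^ (2 * (n + 1)))) := by
  rw [lintegral_ball_enorm_sq_eq_tsum (measurable_deriv g) (hg.deriv Metric.isOpen_ball) ht htr]
  refine tsum_congr fun n => ?_
  congr 1
  rw [← iteratedDeriv_succ', Nat.factorial_succ, norm_div, norm_div, Complex.norm_natCast,
    Complex.norm_natCast]
  have : (n.factorial : ℝ) ≠ 0 := by exact_mod_cast n.factorial_ne_zero
  push_cast
  field_simp

/-! ### Comparison of coefficients and conclusion -/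

/-- The source of the constant: `x ≤ e^(x/e)` for all real `x`, while `r^(2n) ≤ e^(-n/e)`. -/
theorem Real.mul_pow_two_mul_le_one {r : ℝ} (hr0 : 0 ≤ r)
    (hr : r ≤ Real.exp (-(1 / (2 * Real.exp 1)))) (n : ℕ) : n * r ^ (2 * n) ≤ 1 := by
  have h1 : r ^ (2 * n) ≤ Real.exp (-(n / Real.exp 1)) := by
    calc r ^ (2 * n) ≤ Real.exp (-(1 / (2 * Real.exp 1))) ^ (2 * n) := by gcongr
      _ = _ := by
        rw [← Real.exp_nat_mul]
        congr 1
        push_cast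
        field_simp
  have h2 : (n : ℝ) ≤ Real.exp (n / Real.exp 1) := by
    have := Real.add_one_le_exp ((n : ℝ) / Real.exp 1 - 1)
    rw [sub_add_cancel, Real.exp_sub] at this
    exact (div_le_div_iff_of_pos_right (Real.exp_pos 1)).1 this
  calc n * r ^ (2 * n) ≤ Real.exp (n / Real.exp 1) * Real.exp (-(n / Real.exp 1)) := by gcongr
    _ = 1 := by rw [← Real.exp_add, add_neg_cancel, Real.exp_zero]

/-- Finite sums are continuous in the radius, so `ρ ↑ r` needs no convergence at `r`, where the full
series may diverge. -/
theorem sum_norm_taylorCoeff_sq_le_volume_image {g : ℂ → ℂ} {r : ℝ} (hr : 0 < r)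
    (hg : DifferentiableOn ℂ g (Metric.ball 0 r)) (hg0 : g 0 = 0) (s : Finset ℕ) :
    ENNReal.ofReal (Real.pi * ∑ n ∈ s, ‖iteratedDeriv n g 0 / n.factorial‖ ^ 2 * r ^ (2 * n)) ≤
      volume (g '' Metric.ball 0 r) := by
  set F : ℝ → ENNReal := fun ρ => ENNReal.ofReal
    (Real.pi * ∑ n ∈ s, ‖iteratedDeriv n g 0 / n.factorial‖ ^ 2 * ρ ^ (2 * n)) with hF
  have hcont : Continuous F := ENNReal.continuous_ofReal.comp (by fun_prop)
  refine le_of_tendsto ((hcont.tendsto r).mono_left (nhdsWithin_le_nhds (s := Set.Iio r))) ?_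
  filter_upwards [Ioo_mem_nhdsLT hr] with ρ hρ
  have hsub : Metric.closedBall (0 : ℂ) ρ ⊆ Metric.ball 0 r := Metric.closedBall_subset_ball hρ.2
  have hK := (isCompact_closedBall (0 : ℂ) ρ).image_of_continuousOn (hg.continuousOn.mono hsub)
  calc F ρ ≤ ENNReal.ofReal (volume.real (g '' Metric.closedBall 0 ρ)) := by
        refine ENNReal.ofReal_le_ofReal (le_trans ?_
          (pi_mul_circleAverage_le_volume_image hg hg0 hρ.1.le hρ.2))
        gcongr
        refine sum_le_hasSum s (fun n _ => ?_) (hasSum_norm_taylorCoeff_sq hg hρ.1 hρ.2)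
        have := hρ.1
        positivity
    _ = volume (g '' Metric.closedBall 0 ρ) := ENNReal.ofReal_toReal hK.measure_ne_top
    _ ≤ _ := measure_mono (Set.image_mono hsub)

theorem corollary12 (r : ℝ) (hr0 : 0 ≤ r)
    (hr : r ≤ Real.exp (-(1 / (2 * Real.exp 1))))
    (f g : ℂ → ℂ)
    (hf : DifferentiableOn ℂ f (Metric.ball 0 r)) (hf0 : f 0 = 0)
    (hproper : IsProperMap (Set.imageFactorization f (Metric.ball (0 : ℂ) r)))
    (hg : DifferentiableOn ℂ g (Metric.ball 0 r)) (hg0 : g 0 = 0)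
    (hgf : g '' Metric.ball 0 r ⊆ f '' Metric.ball 0 r) :
    ∫⁻ z in Metric.closedBall (0 : ℂ) (r ^ 2), ‖deriv g z‖ₑ ^ 2 ≤
      ∫⁻ z in Metric.closedBall (0 : ℂ) r, ‖deriv f z‖ₑ ^ 2 := by
  rcases hr0.eq_or_lt with rfl | hrpos
  · simp
  have hr1 : r ≤ 1 := hr.trans (Real.exp_le_one_iff.2 (neg_nonpos.2 (by positivity)))
  calc ∫⁻ z in Metric.closedBall (0 : ℂ) (r ^ 2), ‖deriv g z‖ₑ ^ 2
      = ∫⁻ z in Metric.ball (0 : ℂ) (r ^ 2), ‖deriv g z‖ₑ ^ 2 :=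
        setLIntegral_congr (Complex.closedBall_ae_eq_ball (r ^ 2))
    _ ≤ volume (g '' Metric.ball 0 r) := by
        rw [lintegral_ball_enorm_deriv_sq_eq_tsum hg (sq_nonneg r) (by nlinarith)]
        refine ENNReal.tsum_le_of_sum_range_le fun N => ?_
        rw [← ENNReal.ofReal_sum_of_nonneg fun n _ => by positivity, ← Finset.mul_sum]
        refine le_trans (ENNReal.ofReal_le_ofReal ?_)
          (sum_norm_taylorCoeff_sq_le_volume_image hrpos hg hg0
            -- Indices shift by one: the `n`-th term of the series for `g'` carries the coefficient
            -- `bₙ₊₁`.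
            ((Finset.range N).map (addRightEmbedding 1)))
        rw [Finset.sum_map]
        refine mul_le_mul_of_nonneg_left (Finset.sum_le_sum fun n _ => ?_) Real.pi_pos.le
        have h1 := Real.mul_pow_two_mul_le_one hr0 hr (n + 1)
        push_cast at h1
        calc _ = ‖iteratedDeriv (n + 1) g 0 / (n + 1).factorial‖ ^ 2 *
              (((n + 1) * r ^ (2 * (n + 1))) * r ^ (2 * (n + 1))) := by ring
          _ ≤ ‖iteratedDeriv (n + 1) g 0 / (n + 1).factorial‖ ^ 2 *
              (1 * r ^ (2 * (n + 1))) := by gcongr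
          _ = _ := by rw [one_mul]; rfl
    _ ≤ volume (f '' Metric.ball 0 r) := measure_mono hgf
    _ ≤ ∫⁻ z in Metric.ball (0 : ℂ) r, ‖deriv f z‖ₑ ^ 2 :=
        Complex.volume_image_le_lintegral_enorm_deriv_sq Metric.isOpen_ball hf
    _ ≤ _ := lintegral_mono_set Metric.ball_subset_closedBall
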